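/- A (turn-based, two-player) stochastic game $G$ consists of a finite set of states $S=S_\Diamond\uplus S_\Box$ (controller and environment states), an initial state $\bar s\in S$, a finite set of actions $A$, and a partial function $\delta$ that assigns to a pair $(s,a)\in S\times A$ a probability distribution $\delta(s,a)$ on $S$; let $A(s)=\{a\in A\mid \delta(s,a)\text{ is defined}\}$. A (memoryless, possibly randomised) controller strategy $\sigma$, resp. environment strategy $\pi$, assigns to every $s\in S_\Diamond$, resp. $s\in S_\Box$, a probability distribution on $A(s)$. Together they induce from each state $s$ a probability measure on infinite paths $s_0a_0s_1a_1\dots$ with $s_0=s$, and for a function $f:S\times A\to[0,\infty]$ we write $E^{\sigma,\pi}_{s}(f)\in[0,\infty]$ for the expectation of $\sum_{j\ge 0}f(s_j,a_j)$. A multi-strategy $\theta$ assigns to every $s\in S_\Diamond$ a probability distribution $\theta(s)$ on the non-empty subsets of $A(s)$. A controller strategy $\sigma$ complies with $\theta$ if for all $s\in S_\Diamond$ and all non-empty $B\subseteq A(s)$ there is a probability distribution $d_{s,B}$ on $B$ such that $\sigma(s)(a)=\sum_{B\ni a}\theta(s)(B)\,d_{s,B}(a)$ for all $a\in A(s)$.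 Given a reward structure $r:S\times A\to\mathbb{R}_{\ge 0}$ and $b\in\mathbb{R}$, $\theta$ is sound (for the property that the expected total reward is at least $b$) if $E^{\sigma,\pi}_{\bar s}(r)\ge b$ for every $\sigma$ that complies with $\theta$ and every $\pi$. For a penalty function $\psi:S_\Diamond\times A\to\mathbb{R}_{\ge 0}$, the local penalty of $\theta$ at $s\in S_\Diamond$ is $\mathrm{pen}_{loc}(\theta,s)=\sum_{B\subseteq A(s)}\sum_{a\in A(s)\setminus B}\theta(s)(B)\,\psi(s,a)$. The static penalty of $\theta$ is $\sum_{s\in S_\Diamond}\mathrm{pen}_{loc}(\theta,s)$. The dynamic penalty of $\theta$ is the supremum in $[0,\infty]$ of $E^{\sigma,\pi}_{\bar s}(\rho_\theta)$ over all $\sigma$ that comply with $\theta$ and all $\pi$, where $\rho_\theta(s,a)=\mathrm{pen}_{loc}(\theta,s)$ for $s\in S_\Diamond$ and $\rho_\theta(s,a)=0$ for $s\in S_\Box$. Theorem. Let $G$ be a stochastic game, $r$ a reward structure with $\sup_{\sigma,\pi}E^{\sigma,\pi}_{s}(r)<\infty$ for every state $s$, $b\in\mathbb{R}$, and $\psi$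 a penalty function, and consider either static or dynamic penalties. For every sound multi-strategy $\theta$ there is a sound multi-strategy $\theta'$ whose penalty is at most the penalty of $\theta$ and such that for every $s\in S_\Diamond$ the distribution $\theta'(s)$ has at most two sets in its support. -/

import Mathlib

open MeasureTheory ProbabilityTheory
open scoped ENNReal NNReal

/-- A turn-based stochastic two-player game. The state space is the disjoint union `SC ⊕ SE` of the
controller states (`SC`, player `◇`) and the environment states (`SE`, player `□`). The partial
probabilistic transition function is `trans`: it is `none` where it is undefined. -/
structure StochasticGame (SC SE Act : Type*) where
  init : SC ⊕ SE
  trans : SC ⊕ SE → Act → Option (PMF (SC ⊕ SE))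

/-- State-action pairs; an infinite path `s₀ a₀ s₁ a₁ …` is a sequence of them. -/
def StateAction (SC SE Act : Type*) : Type _ := (SC ⊕ SE) × Act

instance (SC SE Act : Type*) : MeasurableSpace (StateAction SC SE Act) := ⊤

instance (SC SE Act : Type*) : DiscreteMeasurableSpace (StateAction SC SE Act) :=
  ⟨fun _ => trivial⟩

namespace StochasticGame

variable {SC SE Act : Type*}

section Strategies

variable [Fintype Act]

/-- The set `A(s)` of actions enabled in `s`. -/
def enabled (G : StochasticGame SC SE Act) (s : SC ⊕ SE) : Finset Act :=
  Finset.univ.filter fun a => (G.trans s a).isSome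

/-- Memoryless (randomised) strategies of the controller. -/
structure ControllerStrategy (G : StochasticGame SC SE Act) where
  choose : SC → PMF Act
  enabled_of_mem_support : ∀ s, ∀ a ∈ (choose s).support, a ∈ G.enabled (Sum.inl s)

/-- Memoryless (randomised) strategies of the environment. -/
structure EnvironmentStrategy (G : StochasticGame SC SE Act) where
  choose : SE → PMF Act
  enabled_of_mem_support : ∀ s, ∀ a ∈ (choose s).support, a ∈ G.enabled (Sum.inr s)

/-- Memoryless (randomised) multi-strategies: in each controller state a distribution over the
non-empty sets of enabled actions. -/
structure MultiStrategy (G : StochasticGame SC SE Act) where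
  choose : SC → PMF (Finset Act)
  empty_eq_zero : ∀ s, choose s ∅ = 0
  subset_enabled : ∀ s, ∀ B ∈ (choose s).support, B ⊆ G.enabled (Sum.inl s)

variable {G : StochasticGame SC SE Act}

/-- The distribution over actions in each state that a pair of strategies determines. -/
def jointChoice (σ : G.ControllerStrategy) (π : G.EnvironmentStrategy) : SC ⊕ SE → PMF Act :=
  Sum.elim σ.choose π.choose

/-- The distribution of the pair `(s, a)` where `a` is chosen in `s` by its owner. -/
noncomputable def actFrom (σ : G.ControllerStrategy) (π : G.EnvironmentStrategy) (s : SC ⊕ SE) :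
    PMF (StateAction SC SE Act) :=
  (jointChoice σ π s).map fun a => (s, a)

/-- The distribution of the next state-action pair. The default value in `getD` is irrelevant:
strategies choose only enabled actions, and on those `trans` is defined. -/
noncomputable def nextStep (σ : G.ControllerStrategy) (π : G.EnvironmentStrategy)
    (x : StateAction SC SE Act) : PMF (StateAction SC SE Act) :=
  ((G.trans x.1 x.2).getD (PMF.pure x.1)).bind (actFrom σ π)

/-- The step of the path at time `n + 1`, given the history up to time `n`. -/
noncomputable def stepKernel (σ : G.ControllerStrategy) (π : G.EnvironmentStrategy) (n : ℕ) :
    Kernel (Π _ : Finset.Iic n, StateAction SC SE Act) (StateAction SC SE Act) where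
  toFun h := (nextStep σ π (h ⟨n, Finset.mem_Iic.2 le_rfl⟩)).toMeasure
  measurable' := (Measurable.of_discrete (f := fun x => (nextStep σ π x).toMeasure)).comp
    (measurable_pi_apply _)

instance (σ : G.ControllerStrategy) (π : G.EnvironmentStrategy) (n : ℕ) :
    IsMarkovKernel (stepKernel σ π n) :=
  ⟨fun _ => PMF.toMeasure.isProbabilityMeasure _⟩

/-- The probability measure over infinite paths from `s` induced by `σ` and `π`. -/
noncomputable def pathMeasure (σ : G.ControllerStrategy) (π : G.EnvironmentStrategy)
    (s : SC ⊕ SE) : Measure (ℕ → StateAction SC SE Act) :=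
  Kernel.trajMeasure (X := fun _ => StateAction SC SE Act) (actFrom σ π s).toMeasure
    (stepKernel σ π)

/-- The expected total reward `E_{G,s}^{σ,π}(r)`. -/
noncomputable def expectedReward (σ : G.ControllerStrategy) (π : G.EnvironmentStrategy)
    (r : SC ⊕ SE → Act → ℝ≥0∞) (s : SC ⊕ SE) : ℝ≥0∞ :=
  ∫⁻ ω, ∑' j, r (ω j).1 (ω j).2 ∂(pathMeasure σ π s)

/-- The maximum possible expected total reward is finite, from every state. -/
def FiniteMaxReward (G : StochasticGame SC SE Act) (r : SC ⊕ SE → Act → ℝ≥0) : Prop :=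
  ∀ s, (⨆ (σ : G.ControllerStrategy) (π : G.EnvironmentStrategy),
    expectedReward σ π (fun t a => (r t a : ℝ≥0∞)) s) < ∞

/-- The property `R^r_{≥ b}[C]`: the expected total reward from the initial state is at least `b`. -/
def Satisfies (σ : G.ControllerStrategy) (π : G.EnvironmentStrategy)
    (r : SC ⊕ SE → Act → ℝ≥0) (b : ℝ) : Prop :=
  ENNReal.ofReal b ≤ expectedReward σ π (fun t a => (r t a : ℝ≥0∞)) G.init

/-- A controller strategy is sound if the property holds against every environment strategy. -/
def ControllerStrategy.Sound (σ : G.ControllerStrategy) (r : SC ⊕ SE → Act → ℝ≥0) (b : ℝ) : Prop :=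
  ∀ π : G.EnvironmentStrategy, Satisfies σ π r b

end Strategies

section MultiStrategies

variable [Fintype Act] [DecidableEq Act] {G : StochasticGame SC SE Act}

/-- `σ` complies with `θ`: after the allowed set `B` is drawn according to `θ`, the action is picked
from `B` by some distribution `d s B`. -/
def ControllerStrategy.Complies (σ : G.ControllerStrategy) (θ : G.MultiStrategy) : Prop :=
  ∃ d : SC → Finset Act → PMF Act,
    (∀ s B, B.Nonempty → B ⊆ G.enabled (Sum.inl s) → (d s B).support ⊆ (B : Set Act)) ∧
    ∀ s, ∀ a ∈ G.enabled (Sum.inl s),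
      σ.choose s a = ∑ B ∈ (G.enabled (Sum.inl s)).powerset with a ∈ B, θ.choose s B * d s B a

/-- A multi-strategy is sound if every strategy that complies with it is sound. -/
def MultiStrategy.Sound (θ : G.MultiStrategy) (r : SC ⊕ SE → Act → ℝ≥0) (b : ℝ) : Prop :=
  ∀ σ : G.ControllerStrategy, σ.Complies θ → σ.Sound r b

/-- The local penalty of `θ` in the controller state `s`. -/
noncomputable def MultiStrategy.localPenalty (θ : G.MultiStrategy) (ψ : SC → Act → ℝ≥0) (s : SC) :
    ℝ≥0∞ :=
  ∑ B ∈ (G.enabled (Sum.inl s)).powerset, ∑ a ∈ G.enabled (Sum.inl s) \ B,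
    θ.choose s B * (ψ s a : ℝ≥0∞)

/-- The static penalty: the sum of the local penalties. -/
noncomputable def MultiStrategy.staticPenalty [Fintype SC] (θ : G.MultiStrategy)
    (ψ : SC → Act → ℝ≥0) : ℝ≥0∞ :=
  ∑ s, θ.localPenalty ψ s

/-- The reward structure that yields the local penalty in each controller state, and nothing in
environment states. -/
noncomputable def MultiStrategy.penaltyReward (θ : G.MultiStrategy) (ψ : SC → Act → ℝ≥0) :
    SC ⊕ SE → Act → ℝ≥0∞ :=
  fun s _ => Sum.elim (θ.localPenalty ψ) (fun _ => 0) s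

/-- The dynamic penalty: the worst-case expected sum of local penalties from the initial state. -/
noncomputable def MultiStrategy.dynamicPenalty (θ : G.MultiStrategy) (ψ : SC → Act → ℝ≥0) : ℝ≥0∞ :=
  ⨆ (σ : G.ControllerStrategy) (_ : σ.Complies θ) (π : G.EnvironmentStrategy),
    expectedReward σ π (θ.penaltyReward ψ) G.init

end MultiStrategies

end StochasticGame

/-- The two types of penalties. -/
inductive PenaltyType
  | sta
  | dyn

/-- The penalty of `θ` under the penalty scheme `(ψ, τ)`. -/
noncomputable def StochasticGame.MultiStrategy.penalty {SC SE Act : Type*} [Fintype SC]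
    [Fintype Act] [DecidableEq Act] {G : StochasticGame SC SE Act} (θ : G.MultiStrategy)
    (ψ : SC → Act → ℝ≥0) : PenaltyType → ℝ≥0∞
  | .sta => θ.staticPenalty ψ
  | .dyn => θ.dynamicPenalty ψ

/-! Let `x` be the least expected total reward when an adversary picks both the action from each
allowed set drawn by `θ` and the environment's actions. Memoryless strategies attain it, so
soundness of `θ` gives `b ≤ x` at the initial state. In a controller state each allowed set `B` has
a value, the least over its actions of the immediate reward plus the expected `x` afterwards, and a
cost, which measures penalties. The `θ`-average of the values is `x`. By planar geometry
(`PMF.exists_two_point`) two of the sets carry a distribution whose average value is no smaller and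
average cost no larger. These distributions form `θ'`.

For undiscounted rewards such local improvement does not suffice: `x` becomes only a subsolution for
`θ'`, and play may circle forever without reward where `x` is a positive constant. By
`PMF.exists_closed_of_not_le` such a trap is the only obstruction. It is excluded by a tie-break. If
all sets in the support have the same value, `θ'` must keep a set that is best for the game
discounted by `1 / 2`, whose value is `u`. In a trap the state that maximises `u` would satisfy `u ≤
u / 2`, so `u` and hence `x` would vanish there (`Improves.minValue_le_expectedReward`).

For static penalties the cost of `B` is its blocking penalty. For dynamic ones the worst expected
future penalty is added, measured by the limit `y` of the discounted worst-case penalties of `θ`.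
This `y` is a supersolution for `θ`, hence for `θ'`, and at the initial state it is at most the
dynamic penalty of `θ`. -/

namespace PMF

/-! ### Expectations of extended non-negative functions. -/

variable {α β : Type*}

/-- The expectation of a non-negative function. -/
noncomputable def mean (p : PMF α) (f : α → ℝ≥0∞) : ℝ≥0∞ := ∑' a, p a * f a

theorem mean_congr {p : PMF α} {f g : α → ℝ≥0∞} (h : ∀ a ∈ p.support, f a = g a) :
    p.mean f = p.mean g := by
  refine tsum_congr fun a => ?_
  by_cases ha : a ∈ p.support
  · rw [h a ha]
  · rw [(p.apply_eq_zero_iff a).2 ha, zero_mul, zero_mul]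

theorem mean_mono {p : PMF α} {f g : α → ℝ≥0∞} (h : ∀ a ∈ p.support, f a ≤ g a) :
    p.mean f ≤ p.mean g := by
  refine ENNReal.tsum_le_tsum fun a => ?_
  by_cases ha : a ∈ p.support
  · exact mul_le_mul_right (h a ha) _
  · rw [(p.apply_eq_zero_iff a).2 ha, zero_mul, zero_mul]

theorem mean_add (p : PMF α) (f g : α → ℝ≥0∞) :
    p.mean (fun a => f a + g a) = p.mean f + p.mean g := by
  simp only [mean, mul_add, ENNReal.tsum_add]

theorem mean_const (p : PMF α) (c : ℝ≥0∞) : p.mean (fun _ => c) = c := by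
  rw [mean, ENNReal.tsum_mul_right, p.tsum_coe, one_mul]

theorem mean_tsum (p : PMF α) {ι : Type*} (f : ι → α → ℝ≥0∞) :
    p.mean (fun a => ∑' i, f i a) = ∑' i, p.mean (f i) := by
  simp only [mean, ← ENNReal.tsum_mul_left]
  exact ENNReal.tsum_comm

theorem mean_sum (p : PMF α) {ι : Type*} (u : Finset ι) (f : ι → α → ℝ≥0∞) :
    p.mean (fun a => ∑ i ∈ u, f i a) = ∑ i ∈ u, p.mean (f i) := by
  simp only [mean, Finset.mul_sum]
  exact Summable.tsum_finsetSum fun _ _ => ENNReal.summable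

theorem mean_pure (a : α) (f : α → ℝ≥0∞) : (PMF.pure a).mean f = f a := by
  classical
  rw [mean, tsum_eq_single a]
  · simp
  · intro b hb
    simp [PMF.pure_apply, hb]

theorem mean_bind (p : PMF α) (q : α → PMF β) (f : β → ℝ≥0∞) :
    (p.bind q).mean f = p.mean fun a => (q a).mean f := by
  simp only [mean, PMF.bind_apply, ← ENNReal.tsum_mul_left, ← ENNReal.tsum_mul_right]
  rw [ENNReal.tsum_comm]
  simp only [mul_assoc]

theorem mean_map (p : PMF α) (g : α → β) (f : β → ℝ≥0∞) :
    (p.map g).mean f = p.mean fun a => f (g a) := by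
  rw [← PMF.bind_pure_comp, mean_bind]
  simp only [Function.comp_apply, mean_pure]

theorem mean_le {p : PMF α} {f : α → ℝ≥0∞} {c : ℝ≥0∞} (h : ∀ a ∈ p.support, f a ≤ c) :
    p.mean f ≤ c :=
  (mean_mono h).trans_eq (p.mean_const c)

theorem le_mean {p : PMF α} {f : α → ℝ≥0∞} {c : ℝ≥0∞} (h : ∀ a ∈ p.support, c ≤ f a) :
    c ≤ p.mean f :=
  (p.mean_const c).symm.trans_le (mean_mono h)

theorem mean_eq_zero_iff {p : PMF α} {f : α → ℝ≥0∞} :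
    p.mean f = 0 ↔ ∀ a ∈ p.support, f a = 0 := by
  simp only [mean, ENNReal.tsum_eq_zero, mul_eq_zero, PMF.mem_support_iff]
  exact forall_congr' fun a => or_iff_not_imp_left

theorem ne_top_of_mean_ne_top {p : PMF α} {f : α → ℝ≥0∞} (h : p.mean f ≠ ∞) :
    ∀ a ∈ p.support, f a ≠ ∞ := by
  intro a ha hf
  refine ENNReal.ne_top_of_tsum_ne_top h a ?_
  rw [hf, ENNReal.mul_top ((p.mem_support_iff a).1 ha)]

/-- A function that is dominated by another one of the same finite expectation agrees with it on
the support. -/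
theorem eq_of_le_of_mean_le {p : PMF α} {f g : α → ℝ≥0∞} (hfg : ∀ a ∈ p.support, f a ≤ g a)
    (h : p.mean g ≤ p.mean f) (hf : p.mean f ≠ ∞) : ∀ a ∈ p.support, f a = g a := by
  have hsum : p.mean g = p.mean f + p.mean fun a => g a - f a := by
    rw [← mean_add]
    exact mean_congr fun a ha => (add_tsub_cancel_of_le (hfg a ha)).symm
  have h0 : p.mean (fun a => g a - f a) = 0 := by
    rw [hsum] at h
    exact le_antisymm ((ENNReal.add_le_add_iff_left hf).1 (h.trans_eq (add_zero _).symm)) zero_le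
  exact fun a ha => le_antisymm (hfg a ha) (tsub_eq_zero_iff_le.1 (mean_eq_zero_iff.1 h0 a ha))

theorem lintegral_toMeasure [Countable α] [MeasurableSpace α] [MeasurableSingletonClass α]
    (p : PMF α) (f : α → ℝ≥0∞) : ∫⁻ a, f a ∂p.toMeasure = p.mean f := by
  rw [lintegral_countable', mean]
  refine tsum_congr fun a => ?_
  rw [PMF.toMeasure_apply_singleton _ _ (measurableSet_singleton a), mul_comm]

end PMF

/-! ### From the path measure to the Bellman equation. -/

namespace StochasticGame

variable {SC SE Act : Type*} [Fintype Act] {G : StochasticGame SC SE Act}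

theorem map_zero_trajMeasure {X : ℕ → Type*} [∀ n, MeasurableSpace (X n)] (μ : Measure (X 0))
    (κ : (n : ℕ) → Kernel (Π i : Finset.Iic n, X i) (X (n + 1))) [∀ n, IsMarkovKernel (κ n)] :
    (Kernel.trajMeasure μ κ).map (fun ω => ω 0) = μ := by
  have h : (fun ω : Π n, X n => ω 0) =
      (fun h : Π i : Finset.Iic 0, X i => h ⟨0, by simp⟩) ∘ Preorder.frestrictLe 0 := rfl
  rw [h, ← Measure.map_map (by fun_prop) (by fun_prop), Kernel.trajMeasure,
    Measure.map_comp _ _ (by fun_prop), Kernel.traj_map_frestrictLe, Kernel.partialTraj_self,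
    Measure.id_comp]
  exact (Measure.map_map (measurable_pi_apply _) (MeasurableEquiv.measurable _)).trans
    Measure.map_id

/-- The distribution of the state-action pair at time `n`. -/
noncomputable def lawAt (σ : G.ControllerStrategy) (π : G.EnvironmentStrategy) (s : SC ⊕ SE) :
    ℕ → PMF (StateAction SC SE Act)
  | 0 => actFrom σ π s
  | n + 1 => (lawAt σ π s n).bind (nextStep σ π)

/-- The distribution of the next state, where the default value is irrelevant. -/
noncomputable def successor (G : StochasticGame SC SE Act) (s : SC ⊕ SE) (a : Act) :
    PMF (SC ⊕ SE) :=
  (G.trans s a).getD (PMF.pure s)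

/-- The expected reward in the `n`-th step. -/
noncomputable def stepReward (σ : G.ControllerStrategy) (π : G.EnvironmentStrategy)
    (f : SC ⊕ SE → Act → ℝ≥0∞) : ℕ → SC ⊕ SE → ℝ≥0∞
  | 0, s => (jointChoice σ π s).mean (f s)
  | n + 1, s => (jointChoice σ π s).mean fun a => (G.successor s a).mean (stepReward σ π f n)

theorem mean_actFrom (σ : G.ControllerStrategy) (π : G.EnvironmentStrategy) (s : SC ⊕ SE)
    (f : StateAction SC SE Act → ℝ≥0∞) :
    (actFrom σ π s).mean f = (jointChoice σ π s).mean fun a => f (s, a) :=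
  PMF.mean_map _ _ _

theorem mean_nextStep (σ : G.ControllerStrategy) (π : G.EnvironmentStrategy) (s : SC ⊕ SE)
    (a : Act) (f : StateAction SC SE Act → ℝ≥0∞) :
    (nextStep σ π (s, a)).mean f = (G.successor s a).mean fun t => (actFrom σ π t).mean f :=
  PMF.mean_bind _ _ _

/-- `lawAt` appends a step at the end of the path, whereas the Bellman equation splits off the first
one; the two agree by associativity of `bind`. -/
theorem mean_lawAt_succ (σ : G.ControllerStrategy) (π : G.EnvironmentStrategy) (s : SC ⊕ SE)
    (n : ℕ) (f : StateAction SC SE Act → ℝ≥0∞) :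
    (lawAt σ π s (n + 1)).mean f =
      (jointChoice σ π s).mean fun a => (G.successor s a).mean fun t => (lawAt σ π t n).mean f := by
  induction n generalizing f with
  | zero =>
    simp only [lawAt, PMF.mean_bind]
    rw [mean_actFrom]
    simp only [mean_nextStep]
  | succ n ih =>
    rw [lawAt, PMF.mean_bind, ih]
    simp only [lawAt, PMF.mean_bind]

theorem mean_lawAt (σ : G.ControllerStrategy) (π : G.EnvironmentStrategy)
    (f : SC ⊕ SE → Act → ℝ≥0∞) (n : ℕ) (s : SC ⊕ SE) :
    ((lawAt σ π s n).mean fun x => f x.1 x.2) = stepReward σ π f n s := by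
  induction n generalizing s with
  | zero =>
    exact mean_actFrom _ _ _ _
  | succ n ih => simp only [mean_lawAt_succ, ih, stepReward]

variable [Finite SC] [Finite SE]

instance : Finite (StateAction SC SE Act) := inferInstanceAs (Finite ((SC ⊕ SE) × Act))

theorem map_eval_pathMeasure (σ : G.ControllerStrategy) (π : G.EnvironmentStrategy) (s : SC ⊕ SE)
    (n : ℕ) : (pathMeasure σ π s).map (fun ω => ω n) = (lawAt σ π s n).toMeasure := by
  induction n with
  | zero => exact map_zero_trajMeasure _ _
  | succ n ih =>
    have hprob : IsProbabilityMeasure (actFrom σ π s).toMeasure :=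
      PMF.toMeasure.isProbabilityMeasure _
    have key := Kernel.map_frestrictLe_trajMeasure_compProd_eq_map_trajMeasure
      (X := fun _ => StateAction SC SE Act) (μ₀ := (actFrom σ π s).toMeasure)
      (κ := stepKernel σ π) (a := n)
    have hpm : IsProbabilityMeasure (pathMeasure σ π s) := by
      unfold pathMeasure; infer_instance
    ext A hA
    -- Evaluating the joint law of history and next pair on `univ ×ˢ A` integrates the history out.
    -- The kernel depends only on the last pair of the history, whose law is known by induction.
    have h1 := congrArg (fun μ => μ (Set.univ ×ˢ A)) key
    rw [Measure.compProd_apply_prod .univ hA, Measure.map_apply (by fun_prop)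
      (MeasurableSet.univ.prod hA), Measure.restrict_univ, lintegral_map
      (Kernel.measurable_coe _ hA) (by fun_prop)] at h1
    rw [Measure.map_apply (by fun_prop) hA]
    have h2 : (fun ω : ℕ → StateAction SC SE Act => ω (n + 1)) ⁻¹' A =
      (fun ω : ℕ → StateAction SC SE Act => (Preorder.frestrictLe n ω, ω (n + 1))) ⁻¹'
        (Set.univ ×ˢ A) := by ext; simp
    rw [h2]
    refine h1.symm.trans ?_
    have h3 : ∀ ω : ℕ → StateAction SC SE Act,
        stepKernel σ π n (Preorder.frestrictLe n ω) A = (nextStep σ π (ω n)).toMeasure A :=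
      fun _ => rfl
    simp only [h3]
    change ∫⁻ ω, (fun x => (nextStep σ π x).toMeasure A) ((fun ω => ω n) ω) ∂pathMeasure σ π s = _
    rw [← lintegral_map (f := fun x => (nextStep σ π x).toMeasure A) .of_discrete (by fun_prop), ih,
      PMF.lintegral_toMeasure, lawAt, PMF.toMeasure_bind_apply _ _ _ hA]
    rfl

theorem expectedReward_eq_tsum (σ : G.ControllerStrategy) (π : G.EnvironmentStrategy)
    (f : SC ⊕ SE → Act → ℝ≥0∞) (s : SC ⊕ SE) :
    expectedReward σ π f s = ∑' n, (lawAt σ π s n).mean fun x => f x.1 x.2 := by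
  have hm : Measurable fun x : StateAction SC SE Act => f x.1 x.2 := .of_discrete
  refine (lintegral_tsum fun n => (hm.comp (measurable_pi_apply n)).aemeasurable).trans ?_
  refine tsum_congr fun n => ?_
  rw [← PMF.lintegral_toMeasure, ← map_eval_pathMeasure,
    lintegral_map hm (measurable_pi_apply n)]
  rfl

theorem expectedReward_eq_tsum_stepReward (σ : G.ControllerStrategy) (π : G.EnvironmentStrategy)
    (f : SC ⊕ SE → Act → ℝ≥0∞) (s : SC ⊕ SE) :
    expectedReward σ π f s = ∑' n, stepReward σ π f n s := by
  simp only [expectedReward_eq_tsum, mean_lawAt]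

theorem expectedReward_eq (σ : G.ControllerStrategy) (π : G.EnvironmentStrategy)
    (f : SC ⊕ SE → Act → ℝ≥0∞) (s : SC ⊕ SE) :
    expectedReward σ π f s = (jointChoice σ π s).mean fun a =>
      f s a + (G.successor s a).mean (expectedReward σ π f) := by
  have h : expectedReward σ π f = fun s => ∑' n, stepReward σ π f n s :=
    funext (expectedReward_eq_tsum_stepReward σ π f)
  simp only [h]
  rw [tsum_eq_zero_add' ENNReal.summable, PMF.mean_add]
  simp only [PMF.mean_tsum, stepReward]

/-- The expected total reward is the least solution of the optimality equations. -/
theorem expectedReward_le (σ : G.ControllerStrategy) (π : G.EnvironmentStrategy)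
    (f : SC ⊕ SE → Act → ℝ≥0∞) (w : SC ⊕ SE → ℝ≥0∞)
    (hw : ∀ s, ((jointChoice σ π s).mean fun a => f s a + (G.successor s a).mean w) ≤ w s)
    (s : SC ⊕ SE) : expectedReward σ π f s ≤ w s := by
  have h : ∀ n s, ∑ i ∈ Finset.range n, stepReward σ π f i s ≤ w s := by
    intro n
    induction n with
    | zero => simp
    | succ n ih =>
      intro s
      refine le_trans (le_of_eq ?_) ((PMF.mean_mono fun a _ =>
        add_le_add_right (PMF.mean_mono fun t _ => ih t) (f s a)).trans (hw s))
      rw [PMF.mean_add, Finset.sum_range_succ', add_comm]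
      simp only [PMF.mean_sum, stepReward]
  rw [expectedReward_eq_tsum_stepReward, ENNReal.tsum_eq_iSup_nat]
  exact iSup_le fun n => h n s

end StochasticGame

/-! ### Reduction to two points, and traps in Markov chains. -/

section TwoPoint

variable {α : Type*}

theorem exists_lt_of_sum_mul_eq_zero {s : Finset α} {w f : α → ℝ} (hw : ∀ i ∈ s, 0 < w i)
    (h : ∑ i ∈ s, w i * f i = 0) {k : α} (hk : k ∈ s) (hfk : 0 < f k) : ∃ i ∈ s, f i < 0 := by
  by_contra! hc
  have := Finset.sum_pos' (fun i hi => mul_nonneg (hw i hi).le (hc i hi))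
    ⟨k, hk, mul_pos (hw k hk) hfk⟩
  exact this.ne' h

/-- A small weight makes the influence of the first value negligible. -/
theorem exists_convex_comb_nonpos (a : ℝ) {c : ℝ} (hc : c < 0) :
    ∃ t u : ℝ, 0 < t ∧ 0 < u ∧ t + u = 1 ∧ t * a + u * c ≤ 0 := by
  have h0 : 0 < |a| - c := by linarith [abs_nonneg a]
  have h1 : 0 < |a| - 2 * c := by linarith
  -- With weights proportional to `-c` and `|a| - c` the combination has numerator `-c * (a - |a| +
  -- c)`, which is nonpositive.
  refine ⟨-c / (|a| - 2 * c), (|a| - c) / (|a| - 2 * c), div_pos (by linarith) h1, div_pos h0 h1,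
    by rw [← add_div, div_eq_one_iff_eq h1.ne']; ring, ?_⟩
  have h2 : -c / (|a| - 2 * c) * a + (|a| - c) / (|a| - 2 * c) * c =
      (-c) * (a - (|a| - c)) / (|a| - 2 * c) := by field_simp; ring
  rw [h2]
  refine div_nonpos_of_nonpos_of_nonneg ?_ h1.le
  have := le_abs_self a
  exact mul_nonpos_of_nonneg_of_nonpos (by linarith) (by linarith)

/-- A family of points `(v i, p i)` with barycentre `0` has a two-point convex combination in the
quadrant `0 ≤ v`, `p ≤ 0`. It can be chosen to use a point with `v i ≠ 0` or, if there is none, to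
use a prescribed point. -/
theorem exists_two_point_of_centred {s : Finset α} {w v p : α → ℝ} (hw : ∀ i ∈ s, 0 < w i)
    (hv : ∑ i ∈ s, w i * v i = 0) (hp : ∑ i ∈ s, w i * p i = 0) {k : α} (hk : k ∈ s) :
    ∃ i ∈ s, ∃ j ∈ s, ∃ t u : ℝ, 0 < t ∧ 0 < u ∧ t + u = 1 ∧ 0 ≤ t * v i + u * v j ∧
      t * p i + u * p j ≤ 0 ∧ (v i ≠ 0 ∨ (∀ l ∈ s, v l = 0) ∧ i = k) := by
  by_cases hall : ∀ l ∈ s, v l = 0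
  · rcases le_or_gt (p k) 0 with hpk | hpk
    · exact ⟨k, hk, k, hk, 1 / 2, 1 / 2, by norm_num, by norm_num, by norm_num,
        by simp [hall k hk], by linarith, Or.inr ⟨hall, rfl⟩⟩
    · obtain ⟨j, hj, hpj⟩ := exists_lt_of_sum_mul_eq_zero hw hp hk hpk
      obtain ⟨t, u, ht, hu, htu, h⟩ := exists_convex_comb_nonpos (p k) hpj
      exact ⟨k, hk, j, hj, t, u, ht, hu, htu, by simp [hall k hk, hall j hj], h,
        Or.inr ⟨hall, rfl⟩⟩
  obtain ⟨i₁, hi₁, hv₁⟩ : ∃ i ∈ s, 0 < v i := by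
    push Not at hall
    obtain ⟨l, hl, hvl⟩ := hall
    rcases lt_or_gt_of_ne hvl with h | h
    · obtain ⟨i, hi, hvi⟩ := exists_lt_of_sum_mul_eq_zero (f := fun i => -v i) hw
        (by simp [hv]) hl (by simpa using h)
      exact ⟨i, hi, by simpa using hvi⟩
    · exact ⟨l, hl, h⟩
  obtain ⟨i₂, hi₂, hv₂⟩ := exists_lt_of_sum_mul_eq_zero hw hv hi₁ hv₁
  by_cases hneg : ∃ j ∈ s, 0 ≤ v j ∧ p j < 0
  · obtain ⟨j, hj, hvj, hpj⟩ := hneg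
    obtain ⟨t, u, ht, hu, htu, h⟩ := exists_convex_comb_nonpos (p i₁) hpj
    exact ⟨i₁, hi₁, j, hj, t, u, ht, hu, htu, by positivity, h, Or.inl hv₁.ne'⟩
  -- Now points with `0 ≤ v` have `0 ≤ p`. Take `i` of least slope `p / v` among those with `0 < v`,
  -- and the line through the origin and `i`. Some `j` with `v j < 0` lies on or below it, since
  -- otherwise the mean of `p - slope * v` would be positive. The segment from `i` to `j` then meets
  -- the axis `v = 0` at a height at most `0`.
  push Not at hneg
  obtain ⟨i, hi, hmin⟩ := Finset.exists_min_image (s.filter fun i => 0 < v i) (fun i => p i / v i)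
    ⟨i₁, by simp [hi₁, hv₁]⟩
  rw [Finset.mem_filter] at hi
  obtain ⟨hi, hvi⟩ := hi
  obtain ⟨j, hj, hvj, hpj⟩ : ∃ j ∈ s, v j < 0 ∧ p j ≤ p i / v i * v j := by
    by_contra! hc
    have hsum : ∑ l ∈ s, w l * (p l - p i / v i * v l) = 0 := by
      simp only [mul_sub, Finset.sum_sub_distrib, hp, mul_left_comm _ (p i / v i),
        ← Finset.mul_sum, hv, mul_zero, sub_zero]
    obtain ⟨l, hl, hlt⟩ := exists_lt_of_sum_mul_eq_zero hw hsum hi₂ (by linarith [hc i₂ hi₂ hv₂])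
    rcases lt_trichotomy (v l) 0 with h | h | h
    · linarith [hc l hl h]
    · rw [h] at hlt
      linarith [hneg l hl h.ge]
    · have := (le_div_iff₀ h).1 (hmin l (by simp [hl, h]))
      linarith
  have hd : 0 < v i - v j := by linarith
  refine ⟨i, hi, j, hj, -v j / (v i - v j), v i / (v i - v j), div_pos (by linarith) hd,
    div_pos hvi hd, by field_simp; ring, (le_of_eq (by field_simp; ring)), ?_, Or.inl hvi.ne'⟩
  have h1 : v i * p j ≤ p i * v j := by
    calc v i * p j ≤ v i * (p i / v i * v j) := mul_le_mul_of_nonneg_left hpj hvi.le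
      _ = p i * v j := by field_simp
  have h2 : -v j / (v i - v j) * p i + v i / (v i - v j) * p j =
      (v i * p j - p i * v j) / (v i - v j) := by field_simp; ring
  rw [h2]
  exact div_nonpos_of_nonpos_of_nonneg (by linarith) hd.le

namespace PMF

theorem mean_eq_sum [Fintype α] (p : PMF α) (f : α → ℝ≥0∞) : p.mean f = ∑ a, p a * f a :=
  tsum_fintype _

open Classical in
theorem toReal_mean [Fintype α] {p : PMF α} {f : α → ℝ≥0∞} (hf : ∀ a ∈ p.support, f a ≠ ∞) :
    ∑ a with a ∈ p.support, (p a).toReal * (f a).toReal = (p.mean f).toReal := by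
  rw [mean_eq_sum, ENNReal.toReal_sum, Finset.sum_filter]
  · refine Finset.sum_congr rfl fun a _ => ?_
    split_ifs with h
    · rw [ENNReal.toReal_mul]
    · rw [(p.apply_eq_zero_iff a).2 h, zero_mul, ENNReal.toReal_zero]
  · intro a _
    by_cases h : a ∈ p.support
    · exact ENNReal.mul_ne_top (p.apply_ne_top a) (hf a h)
    · rw [(p.apply_eq_zero_iff a).2 h, zero_mul]
      exact ENNReal.zero_ne_top

theorem mean_ne_top [Finite α] {p : PMF α} {f : α → ℝ≥0∞} (hf : ∀ a ∈ p.support, f a ≠ ∞) :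
    p.mean f ≠ ∞ := by
  have := Fintype.ofFinite α
  rw [mean_eq_sum]
  refine ENNReal.sum_ne_top.2 fun a _ => ?_
  by_cases h : a ∈ p.support
  · exact ENNReal.mul_ne_top (p.apply_ne_top a) (hf a h)
  · rw [(p.apply_eq_zero_iff a).2 h, zero_mul]
    exact ENNReal.zero_ne_top

/-- The distribution that takes `i` with probability `t` and `j` with probability `u`. -/
noncomputable def twoPoint (t u : ℝ≥0∞) (h : t + u = 1) (i j : α) : PMF α :=
  (PMF.ofFintype (fun b => cond b t u) (by simpa using h)).map fun b => cond b i j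

theorem mean_twoPoint (t u : ℝ≥0∞) (h : t + u = 1) (i j : α) (f : α → ℝ≥0∞) :
    (twoPoint t u h i j).mean f = t * f i + u * f j := by
  rw [twoPoint, mean_map, mean_eq_sum]
  simp

theorem support_twoPoint {t u : ℝ≥0∞} (h : t + u = 1) (ht : t ≠ 0) (hu : u ≠ 0) (i j : α) :
    (twoPoint t u h i j).support = {i, j} := by
  ext a
  simp [twoPoint, ht, hu, eq_comm, or_comm]

theorem exists_two_point_of_ne_top [Finite α] (w : PMF α) {v p : α → ℝ≥0∞}
    (hv : ∀ a ∈ w.support, v a ≠ ∞) (hp : ∀ a ∈ w.support, p a ≠ ∞) {k : α}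
    (hk : k ∈ w.support) :
    ∃ w' : PMF α, w'.support ⊆ w.support ∧ w'.support.ncard ≤ 2 ∧ w.mean v ≤ w'.mean v ∧
      w'.mean p ≤ w.mean p ∧
      ((∃ i ∈ w'.support, v i ≠ w.mean v) ∨
        (∀ l ∈ w.support, v l = w.mean v) ∧ k ∈ w'.support) := by
  classical
  have := Fintype.ofFinite α
  have hw1 : ∑ a with a ∈ w.support, (w a).toReal = 1 := by
    simpa [mean_const] using toReal_mean (p := w) (f := fun _ => 1) (by simp)
  have centred : ∀ f : α → ℝ≥0∞, (∀ a ∈ w.support, f a ≠ ∞) →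
      ∑ a with a ∈ w.support, (w a).toReal * ((f a).toReal - (w.mean f).toReal) = 0 := by
    intro f hf
    simp only [mul_sub, Finset.sum_sub_distrib, ← Finset.sum_mul, hw1, toReal_mean hf]
    ring
  obtain ⟨i, hi, j, hj, t, u, ht, hu, htu, hv', hp', hik⟩ := exists_two_point_of_centred
    (s := Finset.univ.filter (· ∈ w.support))
    (fun a ha => ENNReal.toReal_pos ((w.mem_support_iff a).1 (Finset.mem_filter.1 ha).2)
      (w.apply_ne_top a))
    (centred v hv) (centred p hp) (k := k) (by simpa using hk)
  replace hi : i ∈ w.support := (Finset.mem_filter.1 hi).2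
  replace hj : j ∈ w.support := (Finset.mem_filter.1 hj).2
  have hone : ENNReal.ofReal t + ENNReal.ofReal u = 1 := by
    rw [← ENNReal.ofReal_add ht.le hu.le, htu, ENNReal.ofReal_one]
  have hsupp := support_twoPoint hone (ENNReal.ofReal_pos.2 ht).ne' (ENNReal.ofReal_pos.2 hu).ne'
    i j
  have hmean : ∀ f : α → ℝ≥0∞, (∀ a ∈ w.support, f a ≠ ∞) →
      (twoPoint _ _ hone i j).mean f = ENNReal.ofReal (t * (f i).toReal + u * (f j).toReal) := by
    intro f hf
    rw [mean_twoPoint, ENNReal.ofReal_add (by positivity) (by positivity),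
      ENNReal.ofReal_mul ht.le, ENNReal.ofReal_mul hu.le, ENNReal.ofReal_toReal (hf i hi),
      ENNReal.ofReal_toReal (hf j hj)]
  refine ⟨twoPoint _ _ hone i j, ?_, ?_, ?_, ?_, ?_⟩
  · rw [hsupp]
    exact Set.insert_subset hi (Set.singleton_subset_iff.2 hj)
  · rw [hsupp]
    exact (Set.ncard_insert_le i {j}).trans (by simp)
  · rw [hmean v hv, ← ENNReal.ofReal_toReal (mean_ne_top hv)]
    refine ENNReal.ofReal_le_ofReal ?_
    have : t * (w.mean v).toReal + u * (w.mean v).toReal = (w.mean v).toReal := by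
      rw [← add_mul, htu, one_mul]
    linarith
  · rw [hmean p hp]
    refine ENNReal.ofReal_le_of_le_toReal ?_
    have : t * (w.mean p).toReal + u * (w.mean p).toReal = (w.mean p).toReal := by
      rw [← add_mul, htu, one_mul]
    linarith
  · rw [hsupp]
    rcases hik with h | ⟨h, rfl⟩
    · exact Or.inl ⟨i, by simp, fun hne => h (by rw [hne, sub_self])⟩
    · refine Or.inr ⟨fun l hl => ?_, by simp⟩
      exact (ENNReal.toReal_eq_toReal_iff' (hv l hl) (mean_ne_top hv)).1
        (sub_eq_zero.1 (h l (by simpa using hl)))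

/-- Every finite distribution can be replaced by one that takes at most two of its values such that
the expectation of `v` does not decrease and the expectation of `p` does not increase. -/
theorem exists_two_point [Finite α] (w : PMF α) {v p : α → ℝ≥0∞}
    (hv : ∀ a ∈ w.support, v a ≠ ∞) {k : α} (hk : k ∈ w.support) :
    ∃ w' : PMF α, w'.support ⊆ w.support ∧ w'.support.ncard ≤ 2 ∧ w.mean v ≤ w'.mean v ∧
      w'.mean p ≤ w.mean p ∧
      ((∃ i ∈ w'.support, v i ≠ w.mean v) ∨
        (∀ l ∈ w.support, v l = w.mean v) ∧ k ∈ w'.support) := by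
  -- An infinite mean cost imposes no constraint, so `p` may be replaced by `0`.
  by_cases hp : w.mean p = ∞
  · obtain ⟨w', h1, h2, h3, -, h5⟩ :=
      exists_two_point_of_ne_top w (p := fun _ => 0) hv (by simp) hk
    exact ⟨w', h1, h2, h3, hp ▸ le_top, h5⟩
  · exact exists_two_point_of_ne_top w hv (ne_top_of_mean_ne_top hp) hk

/-- Comparison of a solution of the equations for the expected total reward of a finite Markov
chain with a subsolution: where the latter is larger, the chain can be trapped without reward in a
set where the subsolution is a positive constant. -/
theorem exists_closed_of_not_le [Finite α] {K : α → PMF α} {ρ x z : α → ℝ≥0∞}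
    (hz : ∀ s, z s = ρ s + (K s).mean z) (hx : ∀ s, x s ≤ ρ s + (K s).mean x)
    (hztop : ∀ s, z s ≠ ∞) (hxtop : ∀ s, x s ≠ ∞) (hxz : ¬ x ≤ z) :
    ∃ C : Set α, C.Nonempty ∧ ∃ c ≠ 0, ∀ s ∈ C, (K s).support ⊆ C ∧ ρ s = 0 ∧ x s = c := by
  have hne : Nonempty α := by
    rw [Pi.le_def] at hxz
    push Not at hxz
    exact hxz.nonempty
  obtain ⟨s₀, hs₀⟩ := Finite.exists_max fun s => x s - z s
  set M := x s₀ - z s₀ with hM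
  have hM0 : M ≠ 0 := by
    intro h0
    refine hxz fun s => tsub_eq_zero_iff_le.1 (le_antisymm ((hs₀ s).trans_eq h0) zero_le)
  have hMtop : M ≠ ∞ := ne_top_of_le_ne_top (hxtop s₀) tsub_le_self
  have hle : ∀ s, x s ≤ z s + M := fun s => tsub_le_iff_left.1 (hs₀ s)
  have hzK : ∀ s, (K s).mean z ≠ ∞ := fun s h => hztop s (by rw [hz, h, add_top])
  have hρ : ∀ s, ρ s ≠ ∞ := fun s h => hztop s (by rw [hz, h, top_add])
  -- Maximum principle: the states where `x - z` attains its maximum `M` form a closed set.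
  have hD : ∀ s, x s = z s + M → ∀ t ∈ (K s).support, x t = z t + M := by
    intro s hs
    refine eq_of_le_of_mean_le (fun t _ => hle t) ?_ (mean_ne_top fun t _ => hxtop t)
    rw [mean_add, mean_const, ← ENNReal.add_le_add_iff_left (hρ s), ← add_assoc, ← hz, ← hs]
    exact hx s
  have hD₀ : x s₀ = z s₀ + M := by
    refine le_antisymm (hle s₀) ?_
    rw [hM, add_tsub_cancel_of_le]
    by_contra h
    exact hM0 (tsub_eq_zero_iff_le.2 (not_le.1 h).le)
  -- Within that closed set, where `z` is least, `z = ρ + K z` leaves no room for reward or for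
  -- successors with larger `z`. There `x = z + M` is constant, and it is nonzero because `M` is.
  obtain ⟨s₁, hs₁, hmin⟩ := Set.exists_min_image {s | x s = z s + M} z (Set.toFinite _) ⟨s₀, hD₀⟩
  refine ⟨{s | x s = z s + M ∧ z s = z s₁}, ⟨s₁, hs₁, rfl⟩, z s₁ + M, by simp [hM0], ?_⟩
  rintro s ⟨hs, hsm⟩
  have hge : z s₁ ≤ (K s).mean z := le_mean fun t ht => hmin t (hD s hs t ht)
  have hρ0 : ρ s = 0 := by
    have h1 : z s₁ + ρ s ≤ z s₁ + 0 := by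
      rw [add_zero, add_comm]
      exact (add_le_add_right hge _).trans (by rw [← hz, hsm])
    exact le_antisymm ((ENNReal.add_le_add_iff_left (hztop s₁)).1 h1) zero_le
  refine ⟨fun t ht => ⟨hD s hs t ht, ?_⟩, hρ0, by rw [hs, hsm]⟩
  refine (eq_of_le_of_mean_le (f := fun _ => z s₁) (fun t ht => hmin t (hD s hs t ht)) ?_ ?_ t
    ht).symm
  · rw [mean_const, ← hsm, hz s, hρ0, zero_add]
  · rw [mean_const]
    exact hztop s₁

end PMF

end TwoPoint

namespace StochasticGame

variable {SC SE Act : Type*} [Fintype Act] {G : StochasticGame SC SE Act}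

theorem MultiStrategy.nonempty_of_mem_support (θ : G.MultiStrategy) {s : SC} {B : Finset Act}
    (hB : B ∈ (θ.choose s).support) : B.Nonempty := by
  rw [Finset.nonempty_iff_ne_empty]
  rintro rfl
  exact (PMF.mem_support_iff _ _).1 hB (θ.empty_eq_zero s)

theorem EnvironmentStrategy.enabled_nonempty (π : G.EnvironmentStrategy) (s : SE) :
    (G.enabled (Sum.inr s)).Nonempty :=
  let ⟨a, ha⟩ := (π.choose s).support_nonempty
  ⟨a, π.enabled_of_mem_support s a ha⟩

theorem FiniteMaxReward.expectedReward_ne_top {r : SC ⊕ SE → Act → ℝ≥0}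
    (hr : G.FiniteMaxReward r) (σ : G.ControllerStrategy) (π : G.EnvironmentStrategy)
    (s : SC ⊕ SE) : expectedReward σ π (fun t a => (r t a : ℝ≥0∞)) s ≠ ∞ :=
  ((le_iSup₂ (f := fun σ π => expectedReward σ π (fun t a => (r t a : ℝ≥0∞)) s) σ π).trans_lt
    (hr s)).ne

theorem nonempty_action (θ : G.MultiStrategy) (π : G.EnvironmentStrategy) : Nonempty Act := by
  rcases G.init with s | s
  · obtain ⟨B, hB⟩ := (θ.choose s).support_nonempty
    exact (θ.nonempty_of_mem_support hB).to_type
  · exact (π.enabled_nonempty s).to_type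

/-! ### Bellman operators -/

/-- The least expected reward over one step and `γ` times the value `V` afterwards, for an opponent
who picks the actions both in the allowed sets and in the environment states. -/
noncomputable def minOp (θ : G.MultiStrategy) (f : SC ⊕ SE → Act → ℝ≥0∞) (γ : ℝ≥0∞) :
    (SC ⊕ SE → ℝ≥0∞) →o (SC ⊕ SE → ℝ≥0∞) where
  toFun V := Sum.elim
    (fun s => (θ.choose s).mean fun B =>
      B.inf fun a => f (Sum.inl s) a + γ * (G.successor (Sum.inl s) a).mean V)
    (fun s => (G.enabled (Sum.inr s)).inf fun a =>
      f (Sum.inr s) a + γ * (G.successor (Sum.inr s) a).mean V)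
  monotone' V W h s := by
    have key : ∀ s a, f s a + γ * (G.successor s a).mean V ≤
        f s a + γ * (G.successor s a).mean W := fun s a => by
      gcongr
      exact PMF.mean_mono fun t _ => h t
    cases s with
    | inl s => exact PMF.mean_mono fun B _ => Finset.inf_mono_fun fun a _ => key _ a
    | inr s => exact Finset.inf_mono_fun fun a _ => key _ a

/-- The least expected total reward over all compliant strategies, discounted by `γ`. -/
noncomputable def minValue (θ : G.MultiStrategy) (f : SC ⊕ SE → Act → ℝ≥0∞) (γ : ℝ≥0∞) :
    SC ⊕ SE → ℝ≥0∞ :=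
  OrderHom.lfp (minOp θ f γ)

theorem minOp_minValue (θ : G.MultiStrategy) (f : SC ⊕ SE → Act → ℝ≥0∞) (γ : ℝ≥0∞) :
    minOp θ f γ (minValue θ f γ) = minValue θ f γ :=
  OrderHom.map_lfp _

theorem minValue_le_of_le_one (θ : G.MultiStrategy) (f : SC ⊕ SE → Act → ℝ≥0∞) {γ : ℝ≥0∞}
    (hγ : γ ≤ 1) : minValue θ f γ ≤ minValue θ f 1 := by
  refine OrderHom.lfp_le _ fun s => ?_
  conv_rhs => rw [← minOp_minValue]
  cases s with
  | inl s =>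
    refine PMF.mean_mono fun B _ => Finset.inf_mono_fun fun a _ => ?_
    gcongr
  | inr s =>
    refine Finset.inf_mono_fun fun a _ => ?_
    gcongr

/-- Where the discounted value vanishes, the adversary has actions without reward that lead only to
states of the same kind. Repeating them forever earns nothing, whatever the discount. -/
theorem minValue_eq_zero_of_discounted (θ : G.MultiStrategy) [hπ : Nonempty G.EnvironmentStrategy]
    (f : SC ⊕ SE → Act → ℝ≥0∞) {γ : ℝ≥0∞} (hγ : γ ≠ 0) {s : SC ⊕ SE}
    (hs : minValue θ f γ s = 0) : minValue θ f 1 s = 0 := by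
  classical
  set u := minValue θ f γ with hu
  set x := minValue θ f 1 with hx
  -- Resetting `x` to `0` where `u` vanishes still gives a supersolution, so the least fixed point
  -- `x` lies below it.
  set V : SC ⊕ SE → ℝ≥0∞ := fun t => if u t = 0 then 0 else x t with hV
  have hVx : V ≤ x := fun t => by
    by_cases h : u t = 0 <;> simp [hV, h]
  have hstay : ∀ t a, f t a + γ * (G.successor t a).mean u = 0 →
      f t a + 1 * (G.successor t a).mean V = 0 := by
    intro t a h
    rw [add_eq_zero, mul_eq_zero, or_iff_right hγ, PMF.mean_eq_zero_iff] at h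
    rw [h.1, zero_add, one_mul, PMF.mean_eq_zero_iff]
    exact fun t' ht' => if_pos (h.2 t' ht')
  have hinf : ∀ (t) (B : Finset Act), B.Nonempty →
      (B.inf fun a => f t a + γ * (G.successor t a).mean u) = 0 →
      (B.inf fun a => f t a + 1 * (G.successor t a).mean V) = 0 := by
    intro t B hB h
    obtain ⟨a, ha, hBa⟩ := Finset.exists_mem_eq_inf B hB fun a =>
      f t a + γ * (G.successor t a).mean u
    rw [hBa] at h
    exact le_antisymm ((Finset.inf_le ha).trans_eq (hstay t a h)) zero_le
  have hle : x ≤ V := by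
    refine OrderHom.lfp_le _ fun t => ?_
    by_cases ht : u t = 0
    · rw [show V t = 0 from if_pos ht]
      rw [hu, ← minOp_minValue, ← hu] at ht
      refine le_of_eq ?_
      cases t with
      | inl t =>
        exact PMF.mean_eq_zero_iff.2 fun B hB => hinf _ B (θ.nonempty_of_mem_support hB)
          (PMF.mean_eq_zero_iff.1 ht B hB)
      | inr t => exact hinf _ _ (hπ.some.enabled_nonempty t) ht
    · rw [show V t = x t from if_neg ht, hx, ← minOp_minValue, ← hx]
      exact (minOp θ f 1).monotone hVx t
  exact le_antisymm ((hle s).trans_eq (if_pos hs)) zero_le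

variable [DecidableEq Act]

/-- Recasts compliance as a two-stage draw, first the set and then the action. Sets outside the
powerset of enabled actions have weight zero, so the finite sum is the full one. -/
theorem ControllerStrategy.Complies.exists_choose_eq_bind {σ : G.ControllerStrategy}
    {θ : G.MultiStrategy} (h : σ.Complies θ) : ∃ d : SC → Finset Act → PMF Act,
      (∀ s, ∀ B ∈ (θ.choose s).support, (d s B).support ⊆ (B : Set Act)) ∧
      ∀ s, σ.choose s = (θ.choose s).bind (d s) := by
  obtain ⟨d, hd, hσ⟩ := h
  have hd' : ∀ s, ∀ B ∈ (θ.choose s).support, (d s B).support ⊆ (B : Set Act) := fun s B hB =>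
    hd s B (θ.nonempty_of_mem_support hB) (θ.subset_enabled s B hB)
  refine ⟨d, hd', fun s => PMF.ext fun a => ?_⟩
  rw [PMF.bind_apply]
  have hzero : ∀ B, ¬(B ∈ (G.enabled (Sum.inl s)).powerset ∧ a ∈ B) →
      θ.choose s B * d s B a = 0 := by
    intro B hB
    rw [mul_eq_zero, or_iff_not_imp_left]
    intro hθ
    have hsupp := (PMF.mem_support_iff _ _).2 hθ
    rw [PMF.apply_eq_zero_iff]
    exact fun ha => hB ⟨Finset.mem_powerset.2 (θ.subset_enabled s B hsupp), hd' s B hsupp ha⟩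
  by_cases ha : a ∈ G.enabled (Sum.inl s)
  · rw [hσ s a ha]
    exact (tsum_eq_sum fun B hB => hzero B (by simpa using hB)).symm
  · rw [(PMF.apply_eq_zero_iff _ _).2 fun h => ha (σ.enabled_of_mem_support s a h)]
    refine (ENNReal.tsum_eq_zero.2 fun B => hzero B ?_).symm
    rintro ⟨h1, h2⟩
    exact ha (Finset.mem_powerset.1 h1 h2)

/-- The strategy that picks the action `c s B` from each allowed set `B`. -/
noncomputable def MultiStrategy.select (θ : G.MultiStrategy) (c : SC → Finset Act → Act)
    (hc : ∀ s B, B.Nonempty → c s B ∈ B) : G.ControllerStrategy where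
  choose s := (θ.choose s).map (c s)
  enabled_of_mem_support s a ha := by
    obtain ⟨B, hB, rfl⟩ := (PMF.mem_support_map_iff _ _ _).1 ha
    exact θ.subset_enabled s B hB (hc s B (θ.nonempty_of_mem_support hB))

theorem MultiStrategy.select_complies (θ : G.MultiStrategy) (c : SC → Finset Act → Act)
    (hc : ∀ s B, B.Nonempty → c s B ∈ B) : (θ.select c hc).Complies θ := by
  refine ⟨fun s B => PMF.pure (c s B), fun s B hB _ => by simpa using hc s B hB, fun s a _ => ?_⟩
  change (θ.choose s).map (c s) a = _
  rw [← PMF.bind_pure_comp, PMF.bind_apply]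
  refine tsum_eq_sum fun B hB => ?_
  rw [mul_eq_zero, or_iff_not_imp_left]
  intro hθ
  have hsupp := (PMF.mem_support_iff _ _).2 hθ
  refine PMF.pure_apply_of_ne _ _ ?_
  rintro rfl
  exact hB (by simpa using
    ⟨θ.subset_enabled s B hsupp, hc s B (θ.nonempty_of_mem_support hsupp)⟩)

/-- Any way of selecting an action from each set of actions is realised by strategies. -/
theorem exists_strategies_of_select (θ : G.MultiStrategy) [hπ : Nonempty G.EnvironmentStrategy]
    (P : SC ⊕ SE → Finset Act → Act → Prop) (hP : ∀ s B, B.Nonempty → ∃ a ∈ B, P s B a) :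
    ∃ (c : SC ⊕ SE → Finset Act → Act) (σ : G.ControllerStrategy) (π : G.EnvironmentStrategy),
      (∀ s B, B.Nonempty → P s B (c s B)) ∧ σ.Complies θ ∧
      (∀ s, jointChoice σ π (Sum.inl s) = (θ.choose s).map (c (Sum.inl s))) ∧
      ∀ s, jointChoice σ π (Sum.inr s) = PMF.pure (c (Sum.inr s) (G.enabled (Sum.inr s))) := by
  obtain ⟨π⟩ := hπ
  have := nonempty_action θ π
  have : ∀ s B, ∃ a, B.Nonempty → a ∈ B ∧ P s B a := fun s B => by
    by_cases hB : B.Nonempty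
    · obtain ⟨a, h⟩ := hP s B hB
      exact ⟨a, fun _ => h⟩
    · exact ⟨Classical.arbitrary _, fun h => (hB h).elim⟩
  choose c hc using this
  refine ⟨c, θ.select (fun s => c (Sum.inl s)) fun s B hB => (hc _ B hB).1,
    ⟨fun s => PMF.pure (c (Sum.inr s) (G.enabled (Sum.inr s))), fun s a ha => ?_⟩,
    fun s B hB => (hc s B hB).2, θ.select_complies _ _, fun _ => rfl, fun _ => rfl⟩
  rw [PMF.mem_support_pure_iff] at ha
  exact ha ▸ (hc _ _ (π.enabled_nonempty s)).1

/-- The largest expected penalty over one step and `γ` times the value `V` afterwards. -/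
noncomputable def maxOp (θ : G.MultiStrategy) (h : SC → Finset Act → ℝ≥0∞) (γ : ℝ≥0∞) :
    (SC ⊕ SE → ℝ≥0∞) →o (SC ⊕ SE → ℝ≥0∞) where
  toFun V := Sum.elim
    (fun s => (θ.choose s).mean fun B =>
      h s B + B.sup fun a => γ * (G.successor (Sum.inl s) a).mean V)
    (fun s => (G.enabled (Sum.inr s)).sup fun a => γ * (G.successor (Sum.inr s) a).mean V)
  monotone' V W hVW s := by
    have key : ∀ s a, γ * (G.successor s a).mean V ≤ γ * (G.successor s a).mean W :=
      fun s a => by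
        gcongr
        exact PMF.mean_mono fun t _ => hVW t
    cases s with
    | inl s =>
      exact PMF.mean_mono fun B _ => add_le_add_right (Finset.sup_mono_fun fun a _ => key _ a) _
    | inr s => exact Finset.sup_mono_fun fun a _ => key _ a

theorem minOp_le_mean {θ : G.MultiStrategy} {σ : G.ControllerStrategy} (hσ : σ.Complies θ)
    (π : G.EnvironmentStrategy) (f : SC ⊕ SE → Act → ℝ≥0∞) (V : SC ⊕ SE → ℝ≥0∞) (s : SC ⊕ SE) :
    minOp θ f 1 V s ≤ (jointChoice σ π s).mean fun a => f s a + (G.successor s a).mean V := by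
  cases s with
  | inl s =>
    obtain ⟨d, hd, hσ⟩ := hσ.exists_choose_eq_bind
    change _ ≤ (σ.choose s).mean _
    rw [hσ, PMF.mean_bind]
    refine PMF.mean_mono fun B hB => PMF.le_mean fun a ha => ?_
    simpa only [one_mul] using Finset.inf_le (f := fun a => f (Sum.inl s) a +
      1 * (G.successor (Sum.inl s) a).mean V) (hd s B hB ha)
  | inr s =>
    refine PMF.le_mean fun a ha => ?_
    rw [← one_mul (PMF.mean _ _)]
    exact Finset.inf_le (f := fun a => f (Sum.inr s) a +
      1 * (G.successor (Sum.inr s) a).mean V) (π.enabled_of_mem_support s a ha)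

/-- The penalty for allowing only the actions of `B`. -/
noncomputable def blockingPenalty (G : StochasticGame SC SE Act) (ψ : SC → Act → ℝ≥0) (s : SC)
    (B : Finset Act) : ℝ≥0∞ :=
  ∑ a ∈ G.enabled (Sum.inl s) \ B, (ψ s a : ℝ≥0∞)

theorem localPenalty_eq_mean (θ : G.MultiStrategy) (ψ : SC → Act → ℝ≥0) (s : SC) :
    θ.localPenalty ψ s = (θ.choose s).mean (G.blockingPenalty ψ s) := by
  simp only [MultiStrategy.localPenalty, ← Finset.mul_sum]
  refine (tsum_eq_sum fun B hB => ?_).symm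
  rw [(PMF.apply_eq_zero_iff _ _).2 fun h => hB (Finset.mem_powerset.2 (θ.subset_enabled s B h)),
    zero_mul]

theorem mean_penaltyReward_le_maxOp {θ : G.MultiStrategy} {σ : G.ControllerStrategy}
    (hσ : σ.Complies θ) (π : G.EnvironmentStrategy) (ψ : SC → Act → ℝ≥0) (V : SC ⊕ SE → ℝ≥0∞)
    (s : SC ⊕ SE) :
    ((jointChoice σ π s).mean fun a => θ.penaltyReward ψ s a + (G.successor s a).mean V) ≤
      maxOp θ (G.blockingPenalty ψ) 1 V s := by
  cases s with
  | inl s =>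
    obtain ⟨d, hd, hσ⟩ := hσ.exists_choose_eq_bind
    change ((σ.choose s).mean fun a => θ.localPenalty ψ s + _) ≤ (θ.choose s).mean _
    rw [PMF.mean_add, PMF.mean_const, localPenalty_eq_mean, hσ, PMF.mean_bind, PMF.mean_add]
    gcongr
    refine PMF.mean_mono fun B hB => PMF.mean_le fun a ha => ?_
    simpa only [one_mul] using Finset.le_sup (f := fun a =>
      1 * (G.successor (Sum.inl s) a).mean V) (hd s B hB ha)
  | inr s =>
    refine PMF.mean_le fun a ha => ?_
    change (0 : ℝ≥0∞) + _ ≤ _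
    rw [zero_add, ← one_mul (PMF.mean _ _)]
    exact Finset.le_sup (f := fun a =>
      1 * (G.successor (Sum.inr s) a).mean V) (π.enabled_of_mem_support s a ha)

theorem exists_strategies_minOp (θ : G.MultiStrategy) [Nonempty G.EnvironmentStrategy]
    (f : SC ⊕ SE → Act → ℝ≥0∞) (V : SC ⊕ SE → ℝ≥0∞) :
    ∃ (σ : G.ControllerStrategy) (π : G.EnvironmentStrategy), σ.Complies θ ∧ ∀ s,
      (jointChoice σ π s).mean (fun a => f s a + (G.successor s a).mean V) =
        minOp θ f 1 V s := by
  obtain ⟨c, σ, π, hc, hσ, hl, hr⟩ := exists_strategies_of_select θ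
    (fun s B a => (B.inf fun a => f s a + 1 * (G.successor s a).mean V) =
      f s a + 1 * (G.successor s a).mean V) fun s B hB => Finset.exists_mem_eq_inf B hB _
  refine ⟨σ, π, hσ, fun s => ?_⟩
  cases s with
  | inl s =>
    rw [hl, PMF.mean_map]
    refine PMF.mean_congr fun B hB => ?_
    rw [hc _ B (θ.nonempty_of_mem_support hB), one_mul]
  | inr s =>
    rw [hr, PMF.mean_pure]
    rw [← one_mul (PMF.mean _ _)]
    exact (hc (Sum.inr s) _ (π.enabled_nonempty s)).symm

theorem exists_strategies_maxOp (θ : G.MultiStrategy) [Nonempty G.EnvironmentStrategy]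
    (ψ : SC → Act → ℝ≥0) (γ : ℝ≥0∞) (V : SC ⊕ SE → ℝ≥0∞) :
    ∃ (σ : G.ControllerStrategy) (π : G.EnvironmentStrategy), σ.Complies θ ∧ ∀ s,
      (jointChoice σ π s).mean
          (fun a => θ.penaltyReward ψ s a + γ * (G.successor s a).mean V) =
        maxOp θ (G.blockingPenalty ψ) γ V s := by
  obtain ⟨c, σ, π, hc, hσ, hl, hr⟩ := exists_strategies_of_select θ
    (fun s B a => (B.sup fun a => γ * (G.successor s a).mean V) =
      γ * (G.successor s a).mean V) fun s B hB => Finset.exists_mem_eq_sup B hB _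
  refine ⟨σ, π, hσ, fun s => ?_⟩
  cases s with
  | inl s =>
    change (PMF.mean _ fun a => θ.localPenalty ψ s + _) = (θ.choose s).mean _
    rw [PMF.mean_add, PMF.mean_const, localPenalty_eq_mean, hl, PMF.mean_map, PMF.mean_add]
    congr 1
    refine PMF.mean_congr fun B hB => ?_
    rw [hc _ B (θ.nonempty_of_mem_support hB)]
  | inr s =>
    rw [hr, PMF.mean_pure]
    change (0 : ℝ≥0∞) + _ = _
    rw [zero_add]
    exact (hc (Sum.inr s) _ (π.enabled_nonempty s)).symm

/-- Greedy choices for `minValue` work: `minValue` is then a supersolution for the induced chain,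
whose expected reward is the least one. Conversely that reward is a prefixed point of `minOp`. -/
theorem exists_expectedReward_eq_minValue [Finite SC] [Finite SE] (θ : G.MultiStrategy)
    [Nonempty G.EnvironmentStrategy]
    (f : SC ⊕ SE → Act → ℝ≥0∞) :
    ∃ (σ : G.ControllerStrategy) (π : G.EnvironmentStrategy), σ.Complies θ ∧
      expectedReward σ π f = minValue θ f 1 := by
  obtain ⟨σ, π, hσ, h⟩ := exists_strategies_minOp θ f (minValue θ f 1)
  refine ⟨σ, π, hσ, le_antisymm ?_ ?_⟩
  · exact expectedReward_le σ π f _ fun s => by rw [h, minOp_minValue]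
  · exact OrderHom.lfp_le _ fun s => by
      rw [expectedReward_eq]
      exact minOp_le_mean hσ π f _ s

end StochasticGame

/-! ### Local improvement preserves the guaranteed reward. -/

namespace StochasticGame

variable {SC SE Act : Type*} [Fintype Act] {G : StochasticGame SC SE Act}

/-- The expectation under `θ'` of the least value that an allowed set guarantees is at least the
value of `θ`, and `θ'` gives the opponent no way to stay forever where the value is positive. -/
def Improves (θ θ' : G.MultiStrategy) (f : SC ⊕ SE → Act → ℝ≥0∞) : Prop :=
  ∀ s, minValue θ f 1 (Sum.inl s) ≤ minOp θ' f 1 (minValue θ f 1) (Sum.inl s) ∧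
    ((∃ B ∈ (θ'.choose s).support,
        (B.inf fun a => f (Sum.inl s) a +
          1 * (G.successor (Sum.inl s) a).mean (minValue θ f 1)) ≠ minValue θ f 1 (Sum.inl s)) ∨
      ∃ B ∈ (θ'.choose s).support, minValue θ f (1 / 2) (Sum.inl s) ≤
        B.inf fun a => f (Sum.inl s) a +
          1 / 2 * (G.successor (Sum.inl s) a).mean (minValue θ f (1 / 2)))

/-- A failure produces a closed set `C` without reward on which `x` is a positive constant. The
tie-break in `Improves` forces the half-discounted value `u` to vanish at its maximum on `C`, and
then `x` vanishes there too. -/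
theorem Improves.minValue_le_expectedReward [Finite SC] [Finite SE] [DecidableEq Act]
    {θ θ' : G.MultiStrategy}
    {f : SC ⊕ SE → Act → ℝ≥0∞} (h : Improves θ θ' f)
    (hx : ∀ s, minValue θ f 1 s ≠ ∞) {σ : G.ControllerStrategy} (hσ : σ.Complies θ')
    (π : G.EnvironmentStrategy) (hz : ∀ s, expectedReward σ π f s ≠ ∞) :
    minValue θ f 1 ≤ expectedReward σ π f := by
  by_contra hnot
  have hπ : Nonempty G.EnvironmentStrategy := ⟨π⟩
  set x := minValue θ f 1 with hxdef
  set u := minValue θ f (1 / 2) with hudef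
  have hxle : ∀ s, x s ≤ (jointChoice σ π s).mean fun a => f s a + (G.successor s a).mean x := by
    intro s
    refine le_trans ?_ (minOp_le_mean hσ π f x s)
    cases s with
    | inl s => exact (h s).1
    | inr s =>
      rw [hxdef]
      exact (congrFun (minOp_minValue θ f 1) (Sum.inr s)).ge
  obtain ⟨C, hC, c, hc, hclosed⟩ := PMF.exists_closed_of_not_le
    (K := fun s => (jointChoice σ π s).bind (G.successor s))
    (ρ := fun s => (jointChoice σ π s).mean (f s)) (x := x) (z := expectedReward σ π f)
    (fun s => by rw [PMF.mean_bind, ← PMF.mean_add]; exact expectedReward_eq σ π f s)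
    (fun s => by rw [PMF.mean_bind, ← PMF.mean_add]; exact hxle s) hz hx hnot
  have hsucc : ∀ s ∈ C, ∀ a ∈ (jointChoice σ π s).support, (G.successor s a).support ⊆ C :=
    fun s hs a ha t ht => (hclosed s hs).1 ((PMF.mem_support_bind_iff _ _ _).2 ⟨a, ha, ht⟩)
  have hf : ∀ s ∈ C, ∀ a ∈ (jointChoice σ π s).support, f s a = 0 :=
    fun s hs => PMF.mean_eq_zero_iff.1 (hclosed s hs).2.1
  obtain ⟨m, hmC, hmax⟩ := Set.exists_max_image C u (Set.toFinite C) hC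
  have hstep : ∀ a ∈ (jointChoice σ π m).support,
      f m a + 1 / 2 * (G.successor m a).mean u ≤ 1 / 2 * u m := by
    intro a ha
    rw [hf m hmC a ha, zero_add]
    gcongr
    exact PMF.mean_le fun t ht => hmax t (hsucc m hmC a ha ht)
  -- Every step from `m` earns nothing and stays in `C`, where `u` is at most `u m`.
  have hum : u m ≤ 1 / 2 * u m := by
    rcases m with m | m
    · obtain ⟨d, hd, hσd⟩ := hσ.exists_choose_eq_bind
      have hact : ∀ B ∈ (θ'.choose m).support,
          ∃ a ∈ B, a ∈ (jointChoice σ π (Sum.inl m)).support := by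
        intro B hB
        obtain ⟨a, ha⟩ := (d m B).support_nonempty
        refine ⟨a, hd m B hB ha, ?_⟩
        change a ∈ (σ.choose m).support
        rw [hσd, PMF.mem_support_bind_iff]
        exact ⟨B, hB, ha⟩
      -- Each set in the support contains a played action, which stays in `C` without reward, so its
      -- value is at most `x m`. As the average is at least `x m`, all values are equal, which rules
      -- out the first alternative of `Improves`.
      have hflat : ∀ B ∈ (θ'.choose m).support, (B.inf fun a => f (Sum.inl m) a +
          1 * (G.successor (Sum.inl m) a).mean x) = x (Sum.inl m) := by
        have hle : ∀ B ∈ (θ'.choose m).support, (B.inf fun a => f (Sum.inl m) a +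
            1 * (G.successor (Sum.inl m) a).mean x) ≤ x (Sum.inl m) := by
          intro B hB
          obtain ⟨a, haB, ha⟩ := hact B hB
          refine (Finset.inf_le haB).trans ?_
          rw [hf _ hmC a ha, zero_add, one_mul]
          refine PMF.mean_le fun t ht => ?_
          rw [(hclosed t (hsucc _ hmC a ha ht)).2.2, (hclosed _ hmC).2.2]
        refine PMF.eq_of_le_of_mean_le hle ?_ ?_
        · rw [PMF.mean_const]
          exact (h m).1
        · exact ne_top_of_le_ne_top (hx (Sum.inl m)) (PMF.mean_le hle)
      rcases (h m).2 with ⟨B, hB, hne⟩ | ⟨B, hB, hle⟩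
      · exact absurd (hflat B hB) hne
      · obtain ⟨a, haB, ha⟩ := hact B hB
        exact hle.trans ((Finset.inf_le haB).trans (hstep a ha))
    · obtain ⟨a, ha⟩ := (jointChoice σ π (Sum.inr m)).support_nonempty
      conv_lhs => rw [hudef, ← minOp_minValue, ← hudef]
      exact (Finset.inf_le (π.enabled_of_mem_support m a ha)).trans (hstep a ha)
  have hutop : u m ≠ ∞ :=
    ne_top_of_le_ne_top (hx m) (minValue_le_of_le_one θ f (by simp) m)
  have hu0 : u m = 0 := by
    by_contra h0
    have := ENNReal.half_lt_self h0 hutop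
    rw [div_eq_mul_inv, mul_comm, ← one_div] at this
    exact hum.not_gt this
  exact hc ((hclosed m hmC).2.2.symm.trans
    (minValue_eq_zero_of_discounted θ f (by simp) hu0))

/-! ### Dynamic penalties -/

variable [DecidableEq Act]

/-- The largest discounted expected total penalty. -/
noncomputable def discountedPenalty (θ : G.MultiStrategy) (ψ : SC → Act → ℝ≥0) (γ : ℝ≥0∞) :
    SC ⊕ SE → ℝ≥0∞ :=
  OrderHom.lfp (maxOp θ (G.blockingPenalty ψ) γ)

theorem maxOp_discountedPenalty (θ : G.MultiStrategy) (ψ : SC → Act → ℝ≥0) (γ : ℝ≥0∞) :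
    maxOp θ (G.blockingPenalty ψ) γ (discountedPenalty θ ψ γ) = discountedPenalty θ ψ γ :=
  OrderHom.map_lfp _

theorem discountedPenalty_mono (θ : G.MultiStrategy) (ψ : SC → Act → ℝ≥0) :
    Monotone (discountedPenalty θ ψ) := by
  intro γ δ hγδ
  refine OrderHom.lfp_le _ fun s => ?_
  conv_rhs => rw [← maxOp_discountedPenalty]
  cases s with
  | inl s =>
    refine PMF.mean_mono fun B _ => add_le_add_right (Finset.sup_mono_fun fun a _ => ?_) _
    gcongr
  | inr s =>
    refine Finset.sup_mono_fun fun a _ => ?_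
    gcongr

theorem discountedPenalty_ne_top [Finite SC] (θ : G.MultiStrategy) (ψ : SC → Act → ℝ≥0) {γ : ℝ≥0∞}
    (hγ : γ < 1) (s : SC ⊕ SE) : discountedPenalty θ ψ γ s ≠ ∞ := by
  have := Fintype.ofFinite SC
  set c : ℝ≥0∞ := ∑ s, ∑ a, (ψ s a : ℝ≥0∞) with hc
  have hctop : c ≠ ∞ := by simp [hc]
  have hγ0 : 1 - γ ≠ 0 := (tsub_pos_of_lt hγ).ne'
  -- The geometric series with per-step penalty at most `c` gives a constant supersolution.
  have hK : c + γ * (c / (1 - γ)) = c / (1 - γ) := by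
    have h1 : (1 - γ) * (c / (1 - γ)) = c :=
      ENNReal.mul_div_cancel hγ0 (ne_top_of_le_ne_top ENNReal.one_ne_top tsub_le_self)
    nth_rewrite 1 [← h1]
    rw [← add_mul, tsub_add_cancel_of_le hγ.le, one_mul]
  have hle : discountedPenalty θ ψ γ ≤ fun _ => c / (1 - γ) := by
    refine OrderHom.lfp_le _ fun s => ?_
    cases s with
    | inl s =>
      refine PMF.mean_le fun B _ => ?_
      simp only [PMF.mean_const]
      rw [← hK]
      refine add_le_add ?_ (Finset.sup_le fun _ _ => by rw [hK])
      exact (Finset.sum_le_sum_of_subset (Finset.subset_univ _)).trans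
        (Finset.single_le_sum (f := fun s => ∑ a, (ψ s a : ℝ≥0∞)) (fun _ _ => zero_le)
          (Finset.mem_univ s))
    | inr s =>
      refine Finset.sup_le fun a _ => ?_
      simp only [PMF.mean_const]
      exact le_add_self.trans_eq hK
  exact ne_top_of_le_ne_top (ENNReal.div_ne_top hctop hγ0) (hle s)

/-- Under strategies greedy for the discounted value `y`, the undiscounted penalty `z` dominates
`y`: the largest excess `M` of `y` over `z` contracts to `M ≤ γ * M`. Discounting supplies both the
finiteness of `M` and the strict contraction. -/
theorem discountedPenalty_le_dynamicPenalty [Finite SC] [Finite SE] (θ : G.MultiStrategy)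
    [Nonempty G.EnvironmentStrategy] (ψ : SC → Act → ℝ≥0) {γ : ℝ≥0∞} (hγ : γ < 1) :
    discountedPenalty θ ψ γ G.init ≤ θ.dynamicPenalty ψ := by
  obtain ⟨σ, π, hσ, heq⟩ := exists_strategies_maxOp θ ψ γ (discountedPenalty θ ψ γ)
  set y := discountedPenalty θ ψ γ with hy
  set z := expectedReward σ π (θ.penaltyReward ψ) with hz
  have htop : ∀ s, y s ≠ ∞ := discountedPenalty_ne_top θ ψ hγ
  rw [hy, maxOp_discountedPenalty, ← hy] at heq
  obtain ⟨s₀, hs₀⟩ : ∃ s₀, ∀ s, y s - z s ≤ y s₀ - z s₀ :=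
    have : Nonempty (SC ⊕ SE) := ⟨G.init⟩
    Finite.exists_max fun s => y s - z s
  set M := y s₀ - z s₀ with hM
  have hMtop : M ≠ ∞ := ne_top_of_le_ne_top (htop s₀) tsub_le_self
  have hle : ∀ s, y s ≤ z s + M := fun s => tsub_le_iff_left.1 (hs₀ s)
  have hcontr : M ≤ γ * M := by
    refine tsub_le_iff_left.2 ?_
    rw [← heq s₀, hz, expectedReward_eq, ← hz]
    rw [← PMF.mean_const (jointChoice σ π s₀) (γ * M), ← PMF.mean_add]
    refine PMF.mean_mono fun a _ => ?_
    rw [add_assoc]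
    gcongr
    calc γ * (G.successor s₀ a).mean y
        ≤ γ * (G.successor s₀ a).mean fun t => z t + M := by
          gcongr
          exact PMF.mean_mono fun t _ => hle t
      _ = γ * (G.successor s₀ a).mean z + γ * M := by rw [PMF.mean_add, PMF.mean_const, mul_add]
      _ ≤ 1 * (G.successor s₀ a).mean z + γ * M := by gcongr
      _ = _ := by rw [one_mul]
  have hM0 : M = 0 := by
    by_contra h0
    have := ENNReal.mul_lt_mul_left h0 hMtop hγ
    rw [one_mul] at this
    exact hcontr.not_gt this
  have hyz : y G.init ≤ z G.init := by simpa [hM0] using hle G.init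
  exact hyz.trans (le_iSup_of_le σ (le_iSup_of_le hσ (le_iSup_of_le π le_rfl)))

end StochasticGame

theorem PMF.mean_iSup {α ι : Type*} [Finite α] [Preorder ι] [IsDirectedOrder ι] (p : PMF α)
    {f : ι → α → ℝ≥0∞} (hf : Monotone f) :
    p.mean (fun a => ⨆ i, f i a) = ⨆ i, p.mean (f i) := by
  have := Fintype.ofFinite α
  simp only [mean_eq_sum, ENNReal.mul_iSup]
  exact ENNReal.finsetSum_iSup_of_monotone fun a i j hij => mul_le_mul_right (hf hij a) _

/-! ### Construction of the two-set multi-strategy. -/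

namespace StochasticGame

variable {SC SE Act : Type*} [Fintype Act] {G : StochasticGame SC SE Act}

theorem exists_improves [Finite SC] [Finite SE] (θ : G.MultiStrategy)
    {f : SC ⊕ SE → Act → ℝ≥0∞} (hf : ∀ s a, f s a ≠ ∞) (hx : ∀ s, minValue θ f 1 s ≠ ∞)
    (p : SC → Finset Act → ℝ≥0∞) : ∃ θ' : G.MultiStrategy, Improves θ θ' f ∧
      (∀ s, (θ'.choose s).mean (p s) ≤ (θ.choose s).mean (p s)) ∧
      ∀ s, (θ'.choose s).support.ncard ≤ 2 := by
  have hmean : ∀ (s : SC) γ, ((θ.choose s).mean fun B => B.inf fun a => f (Sum.inl s) a +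
      γ * (G.successor (Sum.inl s) a).mean (minValue θ f γ)) = minValue θ f γ (Sum.inl s) :=
    fun s γ => congrFun (minOp_minValue θ f γ) (Sum.inl s)
  -- The best set in the support is worth at least the average. This is the point prescribed to
  -- `PMF.exists_two_point` for ties.
  have hbest : ∀ s, ∃ B ∈ (θ.choose s).support, minValue θ f (1 / 2) (Sum.inl s) ≤
      B.inf fun a => f (Sum.inl s) a +
        1 / 2 * (G.successor (Sum.inl s) a).mean (minValue θ f (1 / 2)) := by
    intro s
    obtain ⟨B, hB, hmax⟩ := Set.exists_max_image (θ.choose s).support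
      (fun B => B.inf fun a => f (Sum.inl s) a +
        1 / 2 * (G.successor (Sum.inl s) a).mean (minValue θ f (1 / 2)))
      (Set.toFinite _) (θ.choose s).support_nonempty
    exact ⟨B, hB, (hmean s (1 / 2)).symm.trans_le (PMF.mean_le hmax)⟩
  choose B₀ hB₀ hB₀u using hbest
  have hv : ∀ s, ∀ B ∈ (θ.choose s).support, (B.inf fun a => f (Sum.inl s) a +
      1 * (G.successor (Sum.inl s) a).mean (minValue θ f 1)) ≠ ∞ := by
    intro s B hB
    obtain ⟨a, ha⟩ := θ.nonempty_of_mem_support hB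
    refine ne_top_of_le_ne_top ?_ (Finset.inf_le ha)
    rw [one_mul]
    exact ENNReal.add_ne_top.2 ⟨hf _ _, PMF.mean_ne_top fun t _ => hx t⟩
  choose w hsub hcard hle hp hprop using fun s =>
    PMF.exists_two_point (θ.choose s) (p := p s) (hv s) (hB₀ s)
  refine ⟨⟨w, fun s => ?_, fun s B hB => θ.subset_enabled s B (hsub s hB)⟩, fun s => ⟨?_, ?_⟩, hp,
    hcard⟩
  · rw [PMF.apply_eq_zero_iff]
    exact fun h => (PMF.mem_support_iff _ _).1 (hsub s h) (θ.empty_eq_zero s)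
  · exact (hmean s 1).symm.trans_le (hle s)
  · rcases hprop s with ⟨B, hB, hne⟩ | ⟨-, hB⟩
    · exact Or.inl ⟨B, hB, by rwa [hmean s 1] at hne⟩
    · exact Or.inr ⟨B₀ s, hB, hB₀u s⟩

/-! ### The limit of the discounted penalties -/

variable [DecidableEq Act]

/-- The limit of the discounted penalties as the discount factor tends to `1`. -/
noncomputable def limitPenalty (θ : G.MultiStrategy) (ψ : SC → Act → ℝ≥0) (s : SC ⊕ SE) : ℝ≥0∞ :=
  ⨆ γ : Set.Iio (1 : ℝ≥0∞), discountedPenalty θ ψ γ s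

/-- `maxOp` uses only finite means, finite maxima and products, which commute with increasing
suprema; the fixed-point equations for `γ < 1` therefore pass to the limit. -/
theorem maxOp_limitPenalty_le [Finite SC] [Finite SE] (θ : G.MultiStrategy)
    (ψ : SC → Act → ℝ≥0) :
    maxOp θ (G.blockingPenalty ψ) 1 (limitPenalty θ ψ) ≤ limitPenalty θ ψ := by
  have hne : Nonempty (Set.Iio (1 : ℝ≥0∞)) := ⟨⟨0, by simp⟩⟩
  have hmono : Monotone fun γ : Set.Iio (1 : ℝ≥0∞) => discountedPenalty θ ψ (γ : ℝ≥0∞) :=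
    fun γ δ h => discountedPenalty_mono θ ψ h
  have hone : ⨆ γ : Set.Iio (1 : ℝ≥0∞), (γ : ℝ≥0∞) = 1 := by
    rw [← sSup_eq_iSup']
    exact (isLUB_Iio).sSup_eq
  have hnext : ∀ s a, 1 * (G.successor s a).mean (limitPenalty θ ψ) ≤
      ⨆ γ : Set.Iio (1 : ℝ≥0∞), (γ : ℝ≥0∞) * (G.successor s a).mean (discountedPenalty θ ψ γ) := by
    intro s a
    have h := PMF.mean_iSup (G.successor s a) hmono
    change (G.successor s a).mean (limitPenalty θ ψ) = _ at h
    have hmul := ENNReal.iSup_mul (f := fun γ : Set.Iio (1 : ℝ≥0∞) => (γ : ℝ≥0∞))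
      (a := ⨆ γ : Set.Iio (1 : ℝ≥0∞), (G.successor s a).mean (discountedPenalty θ ψ γ))
    rw [hone] at hmul
    rw [h, hmul]
    refine iSup_le fun γ => ?_
    rw [ENNReal.mul_iSup]
    -- The double supremum over factor and value is reached on the diagonal, by monotonicity in
    -- both.
    refine iSup_le fun δ => le_iSup_of_le (max γ δ) ?_
    exact mul_le_mul' (Subtype.coe_le_coe.2 (le_max_left γ δ))
      (PMF.mean_mono fun t _ => hmono (le_max_right γ δ) t)
  have hsup : ∀ s (B : Finset Act),
      (B.sup fun a => 1 * (G.successor s a).mean (limitPenalty θ ψ)) ≤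
        ⨆ γ : Set.Iio (1 : ℝ≥0∞), B.sup fun a =>
          (γ : ℝ≥0∞) * (G.successor s a).mean (discountedPenalty θ ψ γ) := fun s B =>
    Finset.sup_le fun a ha => (hnext s a).trans (iSup_mono fun γ => Finset.le_sup
      (f := fun a => (γ : ℝ≥0∞) * (G.successor s a).mean (discountedPenalty θ ψ γ)) ha)
  have hfix : ∀ s, limitPenalty θ ψ s = ⨆ γ : Set.Iio (1 : ℝ≥0∞),
      maxOp θ (G.blockingPenalty ψ) γ (discountedPenalty θ ψ γ) s := fun s =>
    iSup_congr fun γ => by rw [maxOp_discountedPenalty]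
  intro s
  rw [hfix]
  cases s with
  | inl s =>
    refine (PMF.mean_mono fun B _ => add_le_add_right (hsup _ B) _).trans ?_
    simp only [ENNReal.add_iSup]
    refine (PMF.mean_iSup (θ.choose s) (f := fun (γ : Set.Iio (1 : ℝ≥0∞)) B =>
      G.blockingPenalty ψ s B + B.sup fun a =>
        (γ : ℝ≥0∞) * (G.successor (Sum.inl s) a).mean (discountedPenalty θ ψ γ))
      fun γ δ h B => add_le_add_right (Finset.sup_mono_fun fun a _ => ?_) _).le
    exact mul_le_mul' h (PMF.mean_mono fun t _ => hmono h t)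
  | inr s => exact hsup _ _

theorem dynamicPenalty_le_limitPenalty [Finite SC] [Finite SE] {θ θ' : G.MultiStrategy}
    {ψ : SC → Act → ℝ≥0} (h : maxOp θ' (G.blockingPenalty ψ) 1 (limitPenalty θ ψ) ≤
      limitPenalty θ ψ) : θ'.dynamicPenalty ψ ≤ limitPenalty θ ψ G.init :=
  iSup_le fun σ => iSup_le fun hσ => iSup_le fun π => expectedReward_le σ π _ _
    (fun s => (mean_penaltyReward_le_maxOp hσ π ψ _ s).trans (h s)) _

theorem limitPenalty_le_dynamicPenalty [Finite SC] [Finite SE] (θ : G.MultiStrategy)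
    [Nonempty G.EnvironmentStrategy] (ψ : SC → Act → ℝ≥0) :
    limitPenalty θ ψ G.init ≤ θ.dynamicPenalty ψ :=
  iSup_le fun γ => discountedPenalty_le_dynamicPenalty θ ψ γ.2

/-- The cost of allowing `B` in the state `s`, where the states reached next are charged with the
penalty of `θ` if penalties are dynamic. -/
noncomputable def allowedSetCost (θ : G.MultiStrategy) (ψ : SC → Act → ℝ≥0) (τ : PenaltyType)
    (s : SC) (B : Finset Act) : ℝ≥0∞ :=
  G.blockingPenalty ψ s B + match τ with
    | .sta => 0
    | .dyn => B.sup fun a => 1 * (G.successor (Sum.inl s) a).mean (limitPenalty θ ψ)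

/-- In the dynamic case the mean cost is `maxOp` applied to `limitPenalty θ ψ`, so the hypothesis
makes this function a supersolution for `θ'` as well, and it bounds the penalty of `θ'`. -/
theorem penalty_le_of_mean_allowedSetCost_le [Fintype SC] [Finite SE] {θ θ' : G.MultiStrategy}
    [Nonempty G.EnvironmentStrategy] {ψ : SC → Act → ℝ≥0} {τ : PenaltyType}
    (h : ∀ s, (θ'.choose s).mean (allowedSetCost θ ψ τ s) ≤
      (θ.choose s).mean (allowedSetCost θ ψ τ s)) : θ'.penalty ψ τ ≤ θ.penalty ψ τ := by
  cases τ with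
  | sta =>
    refine Finset.sum_le_sum fun s _ => ?_
    have hcost : allowedSetCost θ ψ .sta s = G.blockingPenalty ψ s := funext fun _ => add_zero _
    rw [localPenalty_eq_mean, localPenalty_eq_mean, ← hcost]
    exact h s
  | dyn =>
    refine (dynamicPenalty_le_limitPenalty fun s => ?_).trans (limitPenalty_le_dynamicPenalty θ ψ)
    refine le_trans ?_ (maxOp_limitPenalty_le θ ψ s)
    cases s with
    | inl s => exact h s
    | inr s => exact le_rfl

theorem MultiStrategy.Sound.ofReal_le_minValue [Finite SC] [Finite SE] {θ : G.MultiStrategy}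
    [Nonempty G.EnvironmentStrategy] {r : SC ⊕ SE → Act → ℝ≥0} {b : ℝ} (hθ : θ.Sound r b) :
    ENNReal.ofReal b ≤ minValue θ (fun t a => (r t a : ℝ≥0∞)) 1 G.init := by
  obtain ⟨σ, π, hσ, h⟩ := exists_expectedReward_eq_minValue θ fun t a => (r t a : ℝ≥0∞)
  rw [← h]
  exact hθ σ hσ π

theorem FiniteMaxReward.minValue_ne_top [Finite SC] [Finite SE] {r : SC ⊕ SE → Act → ℝ≥0}
    (hr : G.FiniteMaxReward r) (θ : G.MultiStrategy) [Nonempty G.EnvironmentStrategy]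
    (s : SC ⊕ SE) : minValue θ (fun t a => (r t a : ℝ≥0∞)) 1 s ≠ ∞ := by
  obtain ⟨σ, π, -, h⟩ := exists_expectedReward_eq_minValue θ fun t a => (r t a : ℝ≥0∞)
  rw [← h]
  exact hr.expectedReward_ne_top σ π s

/-- The multi-strategy that allows all enabled actions. -/
noncomputable def MultiStrategy.allowAll (h : ∀ s : SC, (G.enabled (Sum.inl s)).Nonempty) :
    G.MultiStrategy where
  choose s := PMF.pure (G.enabled (Sum.inl s))
  empty_eq_zero s := PMF.pure_apply_of_ne _ _ (h s).ne_empty.symm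
  subset_enabled s B hB := by
    rw [PMF.mem_support_pure_iff] at hB
    exact hB.le

theorem MultiStrategy.staticPenalty_allowAll [Fintype SC]
    (h : ∀ s : SC, (G.enabled (Sum.inl s)).Nonempty) (ψ : SC → Act → ℝ≥0) :
    (MultiStrategy.allowAll h).staticPenalty ψ = 0 := by
  refine Finset.sum_eq_zero fun s _ => ?_
  rw [localPenalty_eq_mean, MultiStrategy.allowAll, PMF.mean_pure, blockingPenalty,
    Finset.sdiff_self, Finset.sum_empty]

end StochasticGame

/-! ### The main theorem. -/

open StochasticGame in
theorem mainTheorem8 {SC SE Act : Type*} [Fintype SC] [Fintype SE] [Fintype Act] [DecidableEq Act]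
    (G : StochasticGame SC SE Act) (r : SC ⊕ SE → Act → ℝ≥0) (hr : G.FiniteMaxReward r) (b : ℝ)
    (ψ : SC → Act → ℝ≥0) (τ : PenaltyType) (θ : G.MultiStrategy) (hθ : θ.Sound r b) :
    ∃ θ' : G.MultiStrategy, θ'.Sound r b ∧ θ'.penalty ψ τ ≤ θ.penalty ψ τ ∧
      ∀ s, (θ'.choose s).support.ncard ≤ 2 := by
  cases isEmpty_or_nonempty G.EnvironmentStrategy with
  | inl hπ =>
    -- Without environment strategies soundness is vacuous and dynamic penalties are empty suprema.
    -- Allowing everything then costs nothing in either scheme.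
    have hne : ∀ s : SC, (G.enabled (Sum.inl s)).Nonempty := fun s =>
      let ⟨B, hB⟩ := (θ.choose s).support_nonempty
      (θ.nonempty_of_mem_support hB).mono (θ.subset_enabled s B hB)
    refine ⟨.allowAll hne, fun _ _ π => hπ.elim π, ?_, fun s => ?_⟩
    · cases τ with
      | sta => exact (MultiStrategy.staticPenalty_allowAll hne ψ).trans_le zero_le
      | dyn => exact iSup_le fun _ => iSup_le fun _ => iSup_le fun π => hπ.elim π
    · change (PMF.pure _).support.ncard ≤ 2
      simp
  | inr hπ =>
    obtain ⟨θ', himp, hpen, hcard⟩ := exists_improves θ (f := fun t a => (r t a : ℝ≥0∞))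
      (fun _ _ => ENNReal.coe_ne_top) (hr.minValue_ne_top θ) (allowedSetCost θ ψ τ)
    refine ⟨θ', fun σ hσ π => ?_, penalty_le_of_mean_allowedSetCost_le hpen, hcard⟩
    exact hθ.ofReal_le_minValue.trans (himp.minValue_le_expectedReward (hr.minValue_ne_top θ) hσ π
      (hr.expectedReward_ne_top σ π) G.init)
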